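/- Consider connected finite simple graphs $G=(V,E)$; write $n=|V|$. Let $N,M:\mathbb{N}\to\mathbb{N}$ be polynomially bounded functions with $N(n)\ge n$ for all $n$. An instance $(G,x)$ is such a graph together with an input $x(v)\in\{0,\dots,M(n)\}$ at each node $v$; a distributed language is a set of instances, and $\bar L$ denotes the complement of $L$ in the set of all instances. An identity assignment gives the nodes pairwise distinct names in $\{1,\dots,N(n)\}$. A labelling assigns a bit string to each node; it has size at most $c\log n$ if each of its strings has length at most $c\log_2 n$. A local algorithm $A$ consists of a constant radius $t$ and a (Turing-)computable function that maps each labelled neighbourhood (the subgraph induced by the nodes at distance at most $t$ from a node $v$, with centre $v$ marked, and with the identities, inputs and labels of its nodes) to accept or reject; $A$ accepts a labelled instance if every node accepts. For $k\ge 0$, $\Sigma_k$ is the class of languages $L$ for which there are an integer $c\ge 0$ and a local algorithm $A$ such that, for every instance $(G,x)$ and every identity assignment, $$(G,x)\in L\iff \exists \ell_1\,\forall \ell_2\,\exists\ell_3\cdots Q\,\ell_k:\ A(G,x,\ell_1,\dots,\ell_k)\text{ accepts},$$ where the $k$ quantifiers alternate and range over labellings of size at most $c\log n$. The class $\Pi_k$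 is defined in the same way, starting with a universal quantifier. Let $\Lambda_k=\Sigma_k$ for odd $k$ and $\Lambda_k=\Pi_k$ for even $k$, let $\text{co-}\Lambda_k=\{L:\bar L\in\Lambda_k\}$, and let $\mathsf{LH}=\bigcup_{k\ge 0}\Lambda_k$. Let 3-COLOURABILITY be the language of the instances $(G,x)$ such that $G$ has a proper 3-colouring, and NON-3-COLOURABILITY its complement. **Theorem.** All inclusions between the classes at the first and second levels are strict: $$\Lambda_1\subsetneq\Lambda_2,\qquad \Lambda_1\subsetneq\text{co-}\Lambda_2,\qquad \text{co-}\Lambda_1\subsetneq\Lambda_2,\qquad \text{co-}\Lambda_1\subsetneq\text{co-}\Lambda_2 .$$ In particular the hierarchy does not collapse to its first level: $\mathsf{LH}\neq\Lambda_1$. Moreover, both NON-3-COLOURABILITY and 3-COLOURABILITY are in $\Lambda_2\cap\text{co-}\Lambda_2$, while NON-3-COLOURABILITY $\notin\Lambda_1$ and 3-COLOURABILITY $\notin\text{co-}\Lambda_1$. -/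

import Mathlib

namespace LocalHierarchy

/-- `N` is bounded by a polynomial in its argument. -/
def PolyBounded (N : ℕ → ℕ) : Prop :=
  ∃ p : Polynomial ℕ, ∀ n : ℕ, N n ≤ p.eval n

/-- An instance `(G, x)`: a connected graph `G` on `n` nodes together with a local input `x v` at
every node `v`, the inputs of an `n`-node graph being natural numbers at most `M n`. -/
structure Config (M : ℕ → ℕ) where
  n : ℕ
  graph : SimpleGraph (Fin n)
  connected : graph.Connected
  input : Fin n → ℕ
  input_le : ∀ v, input v ≤ M n

/-- A distributed language is a set of instances; its complement is the complement of sets. -/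
abbrev DistLanguage (M : ℕ → ℕ) := Set (Config M)

/-- Identity assignments: pairwise distinct names in `{1, …, N n}`. -/
def IsIdAssignment (N : ℕ → ℕ) {n : ℕ} (ident : Fin n → ℕ) : Prop :=
  Function.Injective ident ∧ ∀ v, 1 ≤ ident v ∧ ident v ≤ N n

/-- A labelling assigns a bit string to every node. -/
abbrev Labelling (n : ℕ) := Fin n → List Bool

/-- All labels have at most `c * log n` bits (logarithm in base two). -/
def Labelling.SizeLE {n : ℕ} (c : ℕ) (l : Labelling n) : Prop :=
  ∀ v, ((l v).length : ℝ) ≤ c * Real.logb 2 n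

/-- What a node can know about one node of its neighbourhood: identity, input, list of
labels, and the sorted list of the identities of its neighbours inside the neighbourhood. -/
abbrev NodeRecord := ℕ × ℕ × List (List Bool) × List ℕ

/-- A labelled local neighbourhood: the identity of its centre, and the records of its nodes in
increasing order of the identities. As identities are distinct, this is a canonical description
of the labelled graph, with no reference to the names of its vertices other than identities. -/
abbrev View := ℕ × List NodeRecord

/-- The elements of `S`, listed in increasing order of their identities. -/
noncomputable def sortById {n : ℕ} (ident : Fin n → ℕ) (S : Finset (Fin n)) : List (Fin n) :=
  S.toList.mergeSort (fun a b => decide (ident a ≤ ident b))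

open Classical in
/-- The nodes at distance at most `t` from `v`. -/
noncomputable def ball {n : ℕ} (G : SimpleGraph (Fin n)) (t : ℕ) (v : Fin n) : Finset (Fin n) :=
  Finset.univ.filter (fun u => G.dist v u ≤ t)

open Classical in
/-- The subgraph induced by the nodes at distance at most `t` from `v`, with the identities, the
inputs and the labels of its nodes. -/
noncomputable def view {n : ℕ} (G : SimpleGraph (Fin n)) (x : Fin n → ℕ) (ident : Fin n → ℕ)
    (t : ℕ) (ls : List (Labelling n)) (v : Fin n) : View :=
  (ident v,
    (sortById ident (ball G t v)).map (fun u =>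
      (ident u, x u, ls.map (fun l => l u),
        (sortById ident ((ball G t v).filter (fun w => G.Adj u w))).map ident)))

/-- A local algorithm: a computable function from labelled local neighbourhoods of a constant
radius to accept (`true`) or reject (`false`). -/
structure LocalAlgorithm where
  radius : ℕ
  out : View → Bool
  computable : Computable out

/-- Global acceptance: every node accepts. -/
def LocalAlgorithm.Accepts (A : LocalAlgorithm) {n : ℕ} (G : SimpleGraph (Fin n))
    (x : Fin n → ℕ) (ident : Fin n → ℕ) (ls : List (Labelling n)) : Prop :=
  ∀ v, A.out (view G x ident A.radius ls v) = true

/-- `alternate ok q k P` is `Q₁ l₁, Q₂ l₂, …, Q_k l_k, P [l₁, …, l_k]` with alternating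
quantifiers over labellings that satisfy `ok`; the first quantifier is existential if
`q = true`, and universal if `q = false`. -/
def alternate {n : ℕ} (ok : Labelling n → Prop) :
    Bool → ℕ → (List (Labelling n) → Prop) → Prop
  | _, 0, P => P []
  | true, k + 1, P => ∃ l, ok l ∧ alternate ok false k (fun ls => P (l :: ls))
  | false, k + 1, P => ∀ l, ok l → alternate ok true k (fun ls => P (l :: ls))

/-- The languages decided by a local algorithm with `k` alternating labellings of `O(log n)` bits,
starting with an existential (`q = true`) or a universal (`q = false`) one, whatever the
identity assignment with names in `{1, …, N n}`. -/
def level (N M : ℕ → ℕ) (q : Bool) (k : ℕ) : Set (DistLanguage M) :=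
  {L | ∃ (c : ℕ) (A : LocalAlgorithm), ∀ (I : Config M) (ident : Fin I.n → ℕ),
    IsIdAssignment N ident →
      (I ∈ L ↔ alternate (Labelling.SizeLE c) q k (A.Accepts I.graph I.input ident))}

/-- The class `Σ_k`. -/
def SigmaClass (N M : ℕ → ℕ) (k : ℕ) : Set (DistLanguage M) := level N M true k

/-- The class `Π_k`. -/
def PiClass (N M : ℕ → ℕ) (k : ℕ) : Set (DistLanguage M) := level N M false k

/-- The class `Λ_k`: `Σ_k` for odd `k`, and `Π_k` for even `k`. -/
def Lam (N M : ℕ → ℕ) (k : ℕ) : Set (DistLanguage M) :=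
  if Odd k then SigmaClass N M k else PiClass N M k

/-- The class co-`Λ_k`. -/
def coLam (N M : ℕ → ℕ) (k : ℕ) : Set (DistLanguage M) := {L | Lᶜ ∈ Lam N M k}

/-- The local hierarchy, the union of all `Λ_k`. -/
def LH (N M : ℕ → ℕ) : Set (DistLanguage M) := ⋃ k, Lam N M k

/-- 3-colourability. -/
def threeColourability (M : ℕ → ℕ) : DistLanguage M := {I | I.graph.Colorable 3}

/-- Non-3-colourability. -/
def nonThreeColourability (M : ℕ → ℕ) : DistLanguage M := {I | ¬ I.graph.Colorable 3}

end LocalHierarchy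

namespace LocalHierarchy

open SimpleGraph

/-! ### Views -/

/-! `Λ₁ ⊆ Λ₂` holds because the universal labelling may be ignored. For `co-Λ₁ ⊆ Λ₂`
(`compl_mem_PiClass_two`), the universal player proposes a certificate and the existential player
answers with distances to a node that rejects it; distances in a connected graph are below `n`,
hence fit in `log n` bits. The other two inclusions follow by complementation. A proper 3-colouring
is a certificate of at most one bit per node, so strictness and the rest reduce to one lower bound,
`nonThreeColourability_notMem_SigmaClass_one`.

That bound is a fooling-set argument. For subsets `S`, `T` of the cube `{0,1}^w`, the gadget graph
has two ends that encode `S` and `T`, joined by wires with `O(w)` nodes in each of `L + 1` layers,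
where `L = 2t + 1` and `t` is the radius. A 3-colouring transmits a point of the cube along the
wires, and the ends forbid the points outside `S` and `T`; so the graph is 3-colourable iff `S ∩ T`
is nonempty (`gadgetGraph_colorable_iff`). If accepted certificates for `(S, Sᶜ)` and `(T, Tᶜ)`
agree on the wires, they can be spliced into one for `(S, Tᶜ)`, as no node sees both ends
(`accepts_hybrid`); this gives `S ⊆ T`, and `S = T` by symmetry. The graph has `2^O(w)` nodes, so
the wires carry only `O(w²)` label bits in all, too few to separate the `2^(2^w)` sets `S`. -/

theorem mem_sortById {n : ℕ} {ident : Fin n → ℕ} {S : Finset (Fin n)} {u : Fin n} :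
    u ∈ sortById ident S ↔ u ∈ S := by
  simp [sortById]

theorem nodup_sortById {n : ℕ} (ident : Fin n → ℕ) (S : Finset (Fin n)) :
    (sortById ident S).Nodup :=
  (List.mergeSort_perm _ _).nodup_iff.2 S.nodup_toList

theorem mem_ball {n : ℕ} {G : SimpleGraph (Fin n)} {t : ℕ} {u v : Fin n} :
    u ∈ ball G t v ↔ G.dist v u ≤ t := by
  simp [ball]

open Classical in
/-- The record of the node `u` in the neighbourhood of radius `t` of `v`. -/
noncomputable def nodeRecord {n : ℕ} (G : SimpleGraph (Fin n)) (x ident : Fin n → ℕ) (t : ℕ)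
    (ls : List (Labelling n)) (v u : Fin n) : NodeRecord :=
  (ident u, x u, ls.map (fun l => l u),
    (sortById ident ((ball G t v).filter (fun w => G.Adj u w))).map ident)

theorem view_eq {n : ℕ} (G : SimpleGraph (Fin n)) (x ident : Fin n → ℕ) (t : ℕ)
    (ls : List (Labelling n)) (v : Fin n) :
    view G x ident t ls v =
      (ident v, (sortById ident (ball G t v)).map (nodeRecord G x ident t ls v)) := rfl

theorem exists_center_iff {n : ℕ} (G : SimpleGraph (Fin n)) (x : Fin n → ℕ) {ident : Fin n → ℕ}
    (hid : Function.Injective ident) (t : ℕ) (ls : List (Labelling n)) (v : Fin n)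
    (P : NodeRecord → Prop) :
    (∃ r ∈ (view G x ident t ls v).2, r.1 = (view G x ident t ls v).1 ∧ P r) ↔
      P (nodeRecord G x ident t ls v v) := by
  simp only [view_eq, List.mem_map, mem_sortById, mem_ball]
  constructor
  · rintro ⟨_, ⟨u, -, rfl⟩, hu, h⟩
    obtain rfl : u = v := hid hu
    exact h
  · exact fun h => ⟨_, ⟨v, by simp, rfl⟩, rfl, h⟩

/-- Adjacency to the centre is read off a view by looking for the centre's identity in a record's
neighbour list. Radius at least 1 is needed for the neighbours to be visible. -/
theorem exists_neighbour_iff {n : ℕ} (G : SimpleGraph (Fin n)) (x : Fin n → ℕ) {ident : Fin n → ℕ}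
    (hid : Function.Injective ident) {t : ℕ} (ht : 1 ≤ t) (ls : List (Labelling n)) (v : Fin n)
    (P : NodeRecord → Prop) :
    (∃ r ∈ (view G x ident t ls v).2, (view G x ident t ls v).1 ∈ r.2.2.2 ∧ P r) ↔
      ∃ u, G.Adj v u ∧ P (nodeRecord G x ident t ls v u) := by
  simp only [view_eq, List.mem_map, mem_sortById, mem_ball]
  constructor
  · rintro ⟨_, ⟨u, -, rfl⟩, hu, h⟩
    simp only [nodeRecord, List.mem_map, mem_sortById, Finset.mem_filter] at hu
    obtain ⟨w, ⟨-, hw⟩, hwv⟩ := hu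
    obtain rfl : w = v := hid hwv
    exact ⟨u, hw.symm, h⟩
  · rintro ⟨u, hu, h⟩
    refine ⟨_, ⟨u, by rw [dist_eq_one_iff_adj.2 hu]; exact ht, rfl⟩, ?_, h⟩
    simp only [nodeRecord, List.mem_map, mem_sortById, Finset.mem_filter]
    exact ⟨v, ⟨mem_ball.2 (by simp), hu.symm⟩, rfl⟩

/-- Apply a function to the list of labels of every node of a view. -/
def mapLabels (g : List (List Bool) → List (List Bool)) (V : View) : View :=
  (V.1, V.2.map fun r => (r.1, r.2.1, g r.2.2.1, r.2.2.2))

theorem mapLabels_view {n : ℕ} (G : SimpleGraph (Fin n)) (x ident : Fin n → ℕ) (t : ℕ)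
    {ls ls' : List (Labelling n)} (v : Fin n) {g : List (List Bool) → List (List Bool)}
    (h : ∀ u, g (ls.map fun l => l u) = ls'.map fun l => l u) :
    mapLabels g (view G x ident t ls v) = view G x ident t ls' v := by
  simp only [mapLabels, view_eq, List.map_map]
  congr 1
  refine List.map_congr_left fun u _ => ?_
  simp [nodeRecord, h]

/-- The part of a view that consists of its centre only. -/
def centreView (V : View) : View :=
  (V.1, (V.2.filter fun r => r.1 = V.1).map fun r => (r.1, r.2.1, r.2.2.1, []))

theorem centreView_view {n : ℕ} {G : SimpleGraph (Fin n)} (hG : G.Connected) (x : Fin n → ℕ)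
    {ident : Fin n → ℕ} (hid : Function.Injective ident) (t : ℕ) (ls : List (Labelling n))
    (v : Fin n) :
    centreView (view G x ident t ls v) = view G x ident 0 ls v := by
  classical
  have hball : ball G 0 v = {v} := by
    ext u
    simp [mem_ball, hG.dist_eq_zero_iff, eq_comm]
  have hrec : nodeRecord G x ident 0 ls v v = (ident v, x v, ls.map (fun l => l v), []) := by
    simp [nodeRecord, hball, Finset.filter_singleton, sortById]
  have hfil : (sortById ident (ball G t v)).filter
      ((fun r : NodeRecord => decide (r.1 = ident v)) ∘ nodeRecord G x ident t ls v) = [v] := by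
    have : ((fun r : NodeRecord => decide (r.1 = ident v)) ∘ nodeRecord G x ident t ls v) =
        fun u => decide (u = v) := by
      funext u
      simp [nodeRecord, hid.eq_iff]
    rw [this, List.filter_eq, List.count_eq_one_of_mem (nodup_sortById _ _)
      (mem_sortById.2 (mem_ball.2 (by simp)))]
    rfl
  have hsort : sortById ident {v} = [v] := by simp [sortById]
  have hview : centreView (view G x ident t ls v) = (ident v,
      (((sortById ident (ball G t v)).map (nodeRecord G x ident t ls v)).filter
        fun r => decide (r.1 = ident v)).map fun r => (r.1, r.2.1, r.2.2.1, [])) := rfl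
  rw [hview, List.filter_map, hfil, view_eq, hball, hsort, List.map_singleton,
    List.map_singleton, List.map_singleton, hrec]
  rfl

/-! ### Computability of operations on views -/

theorem primrec_mapLabels {g : List (List Bool) → List (List Bool)} (hg : Primrec g) :
    Primrec (mapLabels g) := by
  unfold mapLabels
  refine Primrec.pair Primrec.fst (Primrec.list_map Primrec.snd ?_)
  have h2 : Primrec fun p : View × NodeRecord => p.2 := Primrec.snd
  exact Primrec.pair (Primrec.fst.comp h2) <| Primrec.pair
    (Primrec.fst.comp (Primrec.snd.comp h2)) <| Primrec.pair
    (hg.comp (Primrec.fst.comp (Primrec.snd.comp (Primrec.snd.comp h2))))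
    (Primrec.snd.comp (Primrec.snd.comp (Primrec.snd.comp h2)))

theorem primrec_centreView : Primrec centreView := by
  unfold centreView
  refine Primrec.pair Primrec.fst (Primrec.list_map ?_ ?_)
  · have h : PrimrecRel fun (r : NodeRecord) (i : ℕ) => r.1 = i :=
      Primrec.eq.comp (Primrec.fst.comp Primrec.fst) Primrec.snd
    exact h.listFilter.comp Primrec.snd Primrec.fst
  · have h2 : Primrec fun p : View × NodeRecord => p.2 := Primrec.snd
    exact Primrec.pair (Primrec.fst.comp h2) <| Primrec.pair
      (Primrec.fst.comp (Primrec.snd.comp h2)) <| Primrec.pair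
      (Primrec.fst.comp (Primrec.snd.comp (Primrec.snd.comp h2))) (Primrec.const [])

theorem primrecPred_exists_center {P : NodeRecord → View → Prop} (hP : PrimrecRel P) :
    PrimrecPred fun V : View => ∃ r ∈ V.2, r.1 = V.1 ∧ P r V := by
  have h : PrimrecRel fun (r : NodeRecord) (V : View) => r.1 = V.1 ∧ P r V :=
    (Primrec.eq.comp (Primrec.fst.comp Primrec.fst) (Primrec.fst.comp Primrec.snd)).and hP
  exact h.exists_mem_list.comp Primrec.snd Primrec.id

theorem primrecRel_exists_neighbour {P : NodeRecord → NodeRecord → Prop} (hP : PrimrecRel P) :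
    PrimrecRel fun (s : NodeRecord) (V : View) => ∃ r ∈ V.2, V.1 ∈ r.2.2.2 ∧ P r s := by
  have hmem : PrimrecRel fun (l : List ℕ) (i : ℕ) => ∃ a ∈ l, a = i :=
    PrimrecRel.exists_mem_list Primrec.eq
  have h : PrimrecRel fun (r : NodeRecord) (b : ℕ × NodeRecord) =>
      (∃ a ∈ r.2.2.2, a = b.1) ∧ P r b.2 :=
    (hmem.comp (Primrec.snd.comp (Primrec.snd.comp (Primrec.snd.comp Primrec.fst)))
      (Primrec.fst.comp Primrec.snd)).and
      (hP.comp Primrec.fst (Primrec.snd.comp Primrec.snd))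
  refine PrimrecPred.of_eq (h.exists_mem_list.comp (Primrec.snd.comp Primrec.snd)
    (Primrec.pair (Primrec.fst.comp Primrec.snd) Primrec.fst)) fun p => ?_
  simp

/-! ### Changing the constants of a one-quantifier algorithm -/

/-- Precompose a local algorithm with a computable function on views, with a new radius. -/
def LocalAlgorithm.precomp (A : LocalAlgorithm) (f : View → View) (hf : Primrec f) (t : ℕ) :
    LocalAlgorithm where
  radius := t
  out := fun V => A.out (f V)
  computable := A.computable.comp hf.to_comp

theorem sizeLE_nil {n : ℕ} (c : ℕ) : Labelling.SizeLE c (fun _ : Fin n => []) := by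
  intro v
  simp only [List.length_nil, Nat.cast_zero]
  have : (1 : ℝ) ≤ n := by exact_mod_cast v.pos
  have := Real.logb_nonneg (b := 2) (by norm_num) this
  positivity

theorem mem_SigmaClass_one {N M : ℕ → ℕ} {L : DistLanguage M} :
    L ∈ SigmaClass N M 1 ↔ ∃ (c : ℕ) (A : LocalAlgorithm), ∀ (I : Config M) (ident : Fin I.n → ℕ),
      IsIdAssignment N ident →
        (I ∈ L ↔ ∃ l, Labelling.SizeLE c l ∧ A.Accepts I.graph I.input ident [l]) := by
  rfl

theorem mem_PiClass_two {N M : ℕ → ℕ} {L : DistLanguage M} :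
    L ∈ PiClass N M 2 ↔ ∃ (c : ℕ) (A : LocalAlgorithm), ∀ (I : Config M) (ident : Fin I.n → ℕ),
      IsIdAssignment N ident →
        (I ∈ L ↔ ∀ l, Labelling.SizeLE c l →
          ∃ l', Labelling.SizeLE c l' ∧ A.Accepts I.graph I.input ident [l, l']) := by
  rfl

/-- Radius 1 lets nodes compare labels with their neighbours, and `c ≥ 1` makes room for distances.
A radius-0 algorithm is run on the centre of a larger view; if `c = 0` all labels are empty, so an
algorithm that erases its labels simulates the old one. -/
theorem exists_one_le_radius {N M : ℕ → ℕ} {L : DistLanguage M} (h : L ∈ SigmaClass N M 1) :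
    ∃ (c : ℕ) (A : LocalAlgorithm), 1 ≤ c ∧ 1 ≤ A.radius ∧
      ∀ (I : Config M) (ident : Fin I.n → ℕ), IsIdAssignment N ident →
        (I ∈ L ↔ ∃ l, Labelling.SizeLE c l ∧ A.Accepts I.graph I.input ident [l]) := by
  obtain ⟨c, A, hA⟩ := mem_SigmaClass_one.1 h
  obtain ⟨A, hr, hA⟩ : ∃ A : LocalAlgorithm, 1 ≤ A.radius ∧
      ∀ (I : Config M) (ident : Fin I.n → ℕ), IsIdAssignment N ident →
        (I ∈ L ↔ ∃ l, Labelling.SizeLE c l ∧ A.Accepts I.graph I.input ident [l]) := by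
    rcases Nat.eq_zero_or_pos A.radius with h0 | h0
    · refine ⟨A.precomp centreView primrec_centreView 1, le_rfl, fun I ident hid => ?_⟩
      rw [hA I ident hid]
      simp only [LocalAlgorithm.Accepts, LocalAlgorithm.precomp,
        centreView_view I.connected _ hid.1, h0]
    · exact ⟨A, h0, hA⟩
  rcases Nat.eq_zero_or_pos c with rfl | hc
  · have hp : Primrec fun _ : List (List Bool) => [([] : List Bool)] := Primrec.const _
    refine ⟨1, A.precomp _ (primrec_mapLabels hp) A.radius, le_rfl, hr, fun I ident hid => ?_⟩
    rw [hA I ident hid]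
    have key : ∀ l : Labelling I.n, (A.precomp _ (primrec_mapLabels hp) A.radius).Accepts
        I.graph I.input ident [l] ↔ A.Accepts I.graph I.input ident [fun _ => []] := fun l => by
      simp only [LocalAlgorithm.Accepts, LocalAlgorithm.precomp]
      refine forall_congr' fun v => ?_
      rw [mapLabels_view (ls' := [fun _ => []]) _ _ _ _ _ (by simp)]
    constructor
    · rintro ⟨l, hl, hacc⟩
      refine ⟨fun _ => [], sizeLE_nil 1, (key _).2 ?_⟩
      have : l = fun _ => [] := by
        funext v
        have := hl v
        simp only [Nat.cast_zero, zero_mul] at this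
        exact List.length_eq_zero_iff.1 (by exact_mod_cast le_antisymm this (by positivity))
      rwa [← this]
    · rintro ⟨l, -, hacc⟩
      exact ⟨_, sizeLE_nil 0, (key l).1 hacc⟩
  · exact ⟨c, A, hc, hr, hA⟩

/-! ### The inclusions -/

theorem SigmaClass_one_subset_PiClass_two (N M : ℕ → ℕ) : SigmaClass N M 1 ⊆ PiClass N M 2 := by
  intro L hL
  obtain ⟨c, A, hA⟩ := mem_SigmaClass_one.1 hL
  refine mem_PiClass_two.2
    ⟨c, A.precomp _ (primrec_mapLabels Primrec.list_tail) A.radius, fun I ident hid => ?_⟩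
  rw [hA I ident hid]
  have key : ∀ l l' : Labelling I.n,
      (A.precomp _ (primrec_mapLabels Primrec.list_tail) A.radius).Accepts
        I.graph I.input ident [l, l'] ↔ A.Accepts I.graph I.input ident [l'] := fun l l' => by
    simp only [LocalAlgorithm.Accepts, LocalAlgorithm.precomp]
    refine forall_congr' fun v => ?_
    rw [mapLabels_view (ls' := [l']) _ _ _ _ _ (by simp)]
  simp only [key]
  exact ⟨fun h _ _ => h, fun h => h _ (sizeLE_nil c)⟩

/-- The number with a given bijective base-two numeral. -/
def numeralValue (l : List Bool) : ℕ :=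
  l.foldr (fun b v => 2 * v + (if b then 2 else 1)) 0

theorem primrec_numeralValue : Primrec numeralValue := by
  have hb : Primrec fun p : List Bool × (Bool × ℕ) => p.2.1 := Primrec.fst.comp Primrec.snd
  have hv : Primrec fun p : List Bool × (Bool × ℕ) => p.2.2 := Primrec.snd.comp Primrec.snd
  have h : Primrec₂ fun (_ : List Bool) (p : Bool × ℕ) => 2 * p.2 + (if p.1 then 2 else 1) :=
    Primrec.nat_add.comp (Primrec.nat_mul.comp (Primrec.const 2) hv)
      (Primrec.ite (Primrec.eq.comp hb (Primrec.const true)) (Primrec.const 2) (Primrec.const 1))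
  exact Primrec.list_foldr Primrec.id (Primrec.const 0) h

/-- In bijective base two, `0` is the empty string and no bit is wasted: a distance `d < n` takes at
most `log₂ n` bits, exactly, even when `n = 1`. -/
theorem exists_numeral (d : ℕ) : ∃ l, numeralValue l = d ∧ 2 ^ l.length ≤ d + 1 := by
  induction d using Nat.strong_induction_on with
  | _ d ih =>
    rcases Nat.eq_zero_or_pos d with rfl | hd
    · exact ⟨[], rfl, le_rfl⟩
    · rcases Nat.even_or_odd' d with ⟨m, rfl | rfl⟩
      · obtain ⟨l, hl, hlen⟩ := ih (m - 1) (by omega)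
        refine ⟨true :: l, ?_, ?_⟩
        · simp only [numeralValue, List.foldr_cons] at hl ⊢
          simp only [hl, if_true]
          omega
        · rw [List.length_cons, pow_succ]
          omega
      · obtain ⟨l, hl, hlen⟩ := ih m (by omega)
        refine ⟨false :: l, ?_, ?_⟩
        · simp only [numeralValue, List.foldr_cons] at hl ⊢
          simp [hl]
        · rw [List.length_cons, pow_succ]
          omega

theorem length_le_logb {k n c : ℕ} (hc : 1 ≤ c) (h : 2 ^ k ≤ n) : (k : ℝ) ≤ c * Real.logb 2 n := by
  have hn : (0 : ℝ) < n := by exact_mod_cast (pow_pos two_pos k).trans_le h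
  have hk : (k : ℝ) ≤ Real.logb 2 n := by
    rw [Real.le_logb_iff_rpow_le one_lt_two hn, Real.rpow_natCast]
    exact_mod_cast h
  have hc' : (1 : ℝ) ≤ c := by exact_mod_cast hc
  exact hk.trans (le_mul_of_one_le_left ((Nat.cast_nonneg k).trans hk) hc')

/-- The value of the second label of a node. -/
def secondValue (r : NodeRecord) : ℕ := numeralValue r.2.2.1.tail.headI

theorem primrec_secondValue : Primrec secondValue :=
  primrec_numeralValue.comp <| Primrec.list_headI.comp <| Primrec.list_tail.comp <|
    Primrec.fst.comp <| Primrec.snd.comp <| Primrec.snd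

/-- The condition that the second labels decrease towards a node of value `0`. -/
def HasSmallerNeighbour (V : View) : Prop :=
  ∃ s ∈ V.2, s.1 = V.1 ∧ ∃ r ∈ V.2, V.1 ∈ r.2.2.2 ∧ secondValue r < secondValue s

/-- The condition that the second label of the centre is `0`. -/
def IsRoot (V : View) : Prop :=
  ∃ s ∈ V.2, s.1 = V.1 ∧ secondValue s = 0

theorem primrecPred_hasSmallerNeighbour : PrimrecPred HasSmallerNeighbour :=
  primrecPred_exists_center <| primrecRel_exists_neighbour <|
    Primrec.nat_lt.comp (primrec_secondValue.comp Primrec.fst)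
      (primrec_secondValue.comp Primrec.snd)

theorem primrecPred_isRoot : PrimrecPred IsRoot := by
  have h : PrimrecRel fun (s : NodeRecord) (_ : View) => secondValue s = 0 :=
    Primrec.eq.comp (primrec_secondValue.comp Primrec.fst) (Primrec.const 0)
  exact primrecPred_exists_center h

open Classical in
/-- The algorithm that checks that the second labelling points to a node at which `A` rejects the
first labelling. -/
noncomputable def LocalAlgorithm.pointToRejection (A : LocalAlgorithm) : LocalAlgorithm where
  radius := A.radius
  out := fun V => bif decide (HasSmallerNeighbour V) then true else
    bif decide (IsRoot V) then !A.out (mapLabels (List.take 1) V) else false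
  computable := by
    have htake : Primrec (List.take 1 : List (List Bool) → List (List Bool)) :=
      (Primrec.list_take.comp (Primrec.const 1) Primrec.id)
    exact Computable.cond primrecPred_hasSmallerNeighbour.decide.to_comp (Computable.const true) <|
      Computable.cond primrecPred_isRoot.decide.to_comp
        (Primrec.not.to_comp.comp (A.computable.comp (primrec_mapLabels htake).to_comp))
        (Computable.const false)

theorem pointToRejection_out {A : LocalAlgorithm} (hr : 1 ≤ A.radius) {n : ℕ}
    (G : SimpleGraph (Fin n)) (x : Fin n → ℕ) {ident : Fin n → ℕ}
    (hid : Function.Injective ident) (l l' : Labelling n) (v : Fin n) :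
    A.pointToRejection.out (view G x ident A.pointToRejection.radius [l, l'] v) = true ↔
      (∃ u, G.Adj v u ∧ numeralValue (l' u) < numeralValue (l' v)) ∨
      (numeralValue (l' v) = 0 ∧ A.out (view G x ident A.radius [l] v) = false) := by
  have h1 : HasSmallerNeighbour (view G x ident A.radius [l, l'] v) ↔
      ∃ u, G.Adj v u ∧ numeralValue (l' u) < numeralValue (l' v) := by
    unfold HasSmallerNeighbour
    rw [exists_center_iff G x hid A.radius [l, l'] v (fun s =>
      ∃ r ∈ (view G x ident A.radius [l, l'] v).2,
        (view G x ident A.radius [l, l'] v).1 ∈ r.2.2.2 ∧ secondValue r < secondValue s),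
      exists_neighbour_iff G x hid hr [l, l'] v (fun r => secondValue r < _)]
    rfl
  have h2 : IsRoot (view G x ident A.radius [l, l'] v) ↔ numeralValue (l' v) = 0 := by
    unfold IsRoot
    rw [exists_center_iff G x hid A.radius [l, l'] v (fun s => secondValue s = 0)]
    rfl
  simp only [LocalAlgorithm.pointToRejection]
  rw [mapLabels_view (ls' := [l]) _ _ _ _ _ (by simp), ← h1, ← h2]
  by_cases a : HasSmallerNeighbour (view G x ident A.radius [l, l'] v) <;>
    by_cases b : IsRoot (view G x ident A.radius [l, l'] v) <;> simp [a, b]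

theorem exists_adj_dist_lt {V : Type*} {G : SimpleGraph V} (hG : G.Connected) {u v : V}
    (h : u ≠ v) : ∃ w, G.Adj v w ∧ G.dist u w < G.dist u v := by
  obtain ⟨p, hp⟩ := hG.exists_walk_length_eq_dist v u
  cases p with
  | nil => exact absurd rfl h
  | @cons _ w _ hadj q =>
    refine ⟨w, hadj, ?_⟩
    rw [dist_comm, dist_comm (u := u), ← hp, Walk.length_cons]
    exact Nat.lt_succ_of_le (dist_le q)

theorem dist_lt_card {V : Type*} [Fintype V] {G : SimpleGraph V} (hG : G.Connected) (u v : V) :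
    G.dist u v < Fintype.card V := by
  obtain ⟨p, hp, hlen⟩ := hG.exists_path_of_dist u v
  exact hlen ▸ hp.length_lt

/-- Distances to a rejecting node decrease along some edge at every other node. Conversely, the
second labels need not be true distances: a node of minimal value has no smaller neighbour, so it
can only pass by rejecting the first labelling. -/
theorem compl_mem_PiClass_two {N M : ℕ → ℕ} {L : DistLanguage M} (hL : L ∈ SigmaClass N M 1) :
    Lᶜ ∈ PiClass N M 2 := by
  obtain ⟨c, A, hc, hr, hA⟩ := exists_one_le_radius hL
  refine mem_PiClass_two.2 ⟨c, A.pointToRejection, fun I ident hid => ?_⟩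
  rw [Set.mem_compl_iff, hA I ident hid]
  simp only [LocalAlgorithm.Accepts, pointToRejection_out hr _ _ hid.1]
  push Not
  refine forall_congr' fun l => imp_congr_right fun _ => ⟨?_, ?_⟩
  · rintro ⟨v₀, hv₀⟩
    choose f hf hlen using exists_numeral
    refine ⟨fun v => f (I.graph.dist v₀ v), fun v => length_le_logb hc ((hlen _).trans ?_), ?_⟩
    · simpa using dist_lt_card I.connected v₀ v
    · intro v
      simp only [hf]
      by_cases h : v₀ = v
      · subst h
        exact Or.inr ⟨by simp, by simpa using hv₀⟩
      · exact Or.inl (exists_adj_dist_lt I.connected h)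
  · rintro ⟨l', -, h⟩
    have := I.connected.nonempty
    obtain ⟨v, hv⟩ := Finite.exists_min fun v => numeralValue (l' v)
    rcases h v with ⟨u, -, hu⟩ | ⟨-, h⟩
    · exact absurd (hv u) (not_le.2 hu)
    · exact ⟨v, by simp [h]⟩

/-! ### 3-colourability has short certificates -/

/-- The condition that the label of the centre has at most one bit and differs from the labels of
the neighbours. -/
def ProperlyLabelled (V : View) : Prop :=
  ∃ s ∈ V.2, s.1 = V.1 ∧ (s.2.2.1.headI.length ≤ 1 ∧
    ¬ ∃ r ∈ V.2, V.1 ∈ r.2.2.2 ∧ r.2.2.1.headI = s.2.2.1.headI)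

theorem primrecPred_properlyLabelled : PrimrecPred ProperlyLabelled := by
  have hl : Primrec fun r : NodeRecord => r.2.2.1.headI :=
    Primrec.list_headI.comp <| Primrec.fst.comp <| Primrec.snd.comp Primrec.snd
  have h1 : PrimrecRel fun (s : NodeRecord) (_ : View) => s.2.2.1.headI.length ≤ 1 :=
    Primrec.nat_le.comp (Primrec.list_length.comp (hl.comp Primrec.fst)) (Primrec.const 1)
  have h2 : PrimrecRel fun r s : NodeRecord => r.2.2.1.headI = s.2.2.1.headI :=
    Primrec.eq.comp (hl.comp Primrec.fst) (hl.comp Primrec.snd)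
  exact primrecPred_exists_center (PrimrecPred.and h1 (primrecRel_exists_neighbour h2).not)

open Classical in
/-- The algorithm that checks a proper 3-colouring. -/
noncomputable def checkColouring : LocalAlgorithm where
  radius := 1
  out := fun V => decide (ProperlyLabelled V)
  computable := primrecPred_properlyLabelled.decide.to_comp

theorem checkColouring_out {n : ℕ} (G : SimpleGraph (Fin n)) (x : Fin n → ℕ) {ident : Fin n → ℕ}
    (hid : Function.Injective ident) (l : Labelling n) (v : Fin n) :
    checkColouring.out (view G x ident checkColouring.radius [l] v) = true ↔
      (l v).length ≤ 1 ∧ ¬ ∃ u, G.Adj v u ∧ l u = l v := by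
  simp only [checkColouring, decide_eq_true_eq]
  unfold ProperlyLabelled
  rw [exists_center_iff G x hid 1 [l] v (fun s => s.2.2.1.headI.length ≤ 1 ∧
    ¬ ∃ r ∈ (view G x ident 1 [l] v).2, (view G x ident 1 [l] v).1 ∈ r.2.2.2 ∧
      r.2.2.1.headI = s.2.2.1.headI),
    exists_neighbour_iff G x hid le_rfl [l] v (fun r => r.2.2.1.headI = _)]
  rfl

/-- The colour of a label. -/
def labelColour : List Bool → Fin 3
  | [] => 0
  | false :: _ => 1
  | true :: _ => 2

/-- `labelColour` reads only the first bit, which is why the checker also bounds the length of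
labels. -/
theorem labelColour_injOn {a b : List Bool} (ha : a.length ≤ 1) (hb : b.length ≤ 1)
    (h : labelColour a = labelColour b) : a = b := by
  rcases a with _ | ⟨_ | _, _ | _⟩ <;> rcases b with _ | ⟨_ | _, _ | _⟩ <;>
    simp_all [labelColour]

/-- The label of a colour. -/
def colourLabel (a : Fin 3) : List Bool := ![[], [false], [true]] a

theorem length_colourLabel_le (a : Fin 3) : (colourLabel a).length ≤ 1 := by
  revert a
  decide

theorem colourLabel_injective : Function.Injective colourLabel := by
  unfold Function.Injective
  decide

theorem threeColourability_mem_SigmaClass_one (N M : ℕ → ℕ) :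
    threeColourability M ∈ SigmaClass N M 1 := by
  refine mem_SigmaClass_one.2 ⟨1, checkColouring, fun I ident hid => ?_⟩
  simp only [LocalAlgorithm.Accepts, checkColouring_out _ _ hid.1]
  constructor
  · rintro ⟨C⟩
    by_cases hn : 2 ≤ I.n
    · refine ⟨fun v => colourLabel (C v), fun v => length_le_logb le_rfl ?_,
        fun v => ⟨length_colourLabel_le _, ?_⟩⟩
      · exact (Nat.pow_le_pow_right two_pos (length_colourLabel_le _)).trans hn
      · rintro ⟨u, hu, h⟩
        exact C.valid hu (colourLabel_injective h).symm
    -- On a single node `log n = 0` allows only empty labels, but there is no edge to check.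
    · refine ⟨fun _ => [], sizeLE_nil 1, fun v => ⟨by simp, ?_⟩⟩
      rintro ⟨u, hu, -⟩
      exact hu.ne (Fin.ext (by omega))
  · rintro ⟨l, -, h⟩
    refine ⟨Coloring.mk (fun v => labelColour (l v)) fun {u v} huv heq => ?_⟩
    exact (h u).2 ⟨v, huv, labelColour_injOn (h v).1 (h u).1 heq.symm⟩

/-! ### Locality of views -/

theorem exists_walk_of_agree {V : Type*} {G H : SimpleGraph V} {pos : V → ℕ} {L : ℕ}
    (hpos : ∀ u v, G.Adj u v → pos v ≤ pos u + 1)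
    (hagree : ∀ u v, pos u < L → pos v < L → G.Adj u v → H.Adj u v) {v u : V} (p : G.Walk v u)
    (h : pos v + p.length < L) :
    ∃ q : H.Walk v u, q.length = p.length ∧ pos u ≤ pos v + p.length := by
  induction p with
  | nil => exact ⟨.nil, rfl, le_rfl⟩
  | @cons v w u hvw p ih =>
    rw [Walk.length_cons] at h ⊢
    have hw := hpos v w hvw
    obtain ⟨q, hq, hu⟩ := ih (by omega)
    exact ⟨.cons (hagree v w (by omega) (by omega) hvw) q, by rw [Walk.length_cons, hq],
      by omega⟩

theorem dist_le_of_agree {V : Type*} {G H : SimpleGraph V} (hG : G.Connected) {pos : V → ℕ}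
    {L t : ℕ} (hpos : ∀ u v, G.Adj u v → pos v ≤ pos u + 1)
    (hagree : ∀ u v, pos u < L → pos v < L → G.Adj u v → H.Adj u v) {v u : V}
    (h : pos v + t < L) (hd : G.dist v u ≤ t) : H.dist v u ≤ t ∧ pos u < L := by
  obtain ⟨p, hp⟩ := hG.exists_walk_length_eq_dist v u
  obtain ⟨q, hq, hu⟩ := exists_walk_of_agree hpos hagree p (by omega)
  exact ⟨(dist_le q).trans (by omega), by omega⟩

/-- `pos` grows by at most 1 along an edge, so a walk of length at most `t` from `v` stays in the
region `pos < L`, where the graphs and the labels coincide. -/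
theorem view_congr_of_agree {n : ℕ} {G H : SimpleGraph (Fin n)} (hG : G.Connected)
    (hH : H.Connected) {pos : Fin n → ℕ} {L t : ℕ} (x ident : Fin n → ℕ) {l l' : Labelling n}
    (hposG : ∀ u v, G.Adj u v → pos v ≤ pos u + 1) (hposH : ∀ u v, H.Adj u v → pos v ≤ pos u + 1)
    (hagree : ∀ u v, pos u < L → pos v < L → (G.Adj u v ↔ H.Adj u v))
    (hl : ∀ v, pos v < L → l v = l' v) {v : Fin n} (h : pos v + t < L) :
    view G x ident t [l] v = view H x ident t [l'] v := by
  classical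
  have hball : ball G t v = ball H t v := by
    ext u
    simp only [mem_ball]
    exact ⟨fun hd => (dist_le_of_agree hG hposG (fun u v hu hv => (hagree u v hu hv).1) h hd).1,
      fun hd => (dist_le_of_agree hH hposH (fun u v hu hv => (hagree u v hu hv).2) h hd).1⟩
  have hlt : ∀ u ∈ ball H t v, pos u < L := fun u hu =>
    (dist_le_of_agree hH hposH (fun u v hu hv => (hagree u v hu hv).2) h (mem_ball.1 hu)).2
  rw [view_eq, view_eq, hball]
  congr 1
  refine List.map_congr_left fun u hu => ?_
  have hu' := hlt u (mem_sortById.1 hu)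
  simp only [nodeRecord, List.map_singleton, hl u hu', hball]
  congr 5
  exact Finset.filter_congr fun w hw => hagree u w hu' (hlt w hw)

/-! ### The gadget graphs

A node of `gadgetGraph L w S T` carries a map from the cube `Fin w → Bool` to the three colours.
Every point of `S ∩ T` gives a proper 3-colouring by evaluation, and all proper 3-colourings arise
in this way on the nodes of the wires, up to a permutation of the colours. -/

/-- The nodes of a layer of the wires: the three colours, and the literals. -/
abbrev WireNode (w : ℕ) := Fin 3 ⊕ (Fin w × Bool)

/-- The nodes that compute, for every point `a` of the cube, whether a point differs from `a`. -/
abbrev CompareNode (w : ℕ) := (Fin w → Bool) × Fin (w + 1) × Fin 3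

/-- The nodes of the gadget graphs: `L + 1` layers of wires, and the nodes of the two ends. -/
abbrev GadgetNode (L w : ℕ) := (Fin (L + 1) × WireNode w) ⊕ (Bool × CompareNode w)

variable {L w : ℕ}

/-- The points `a` and `x` differ in one of the first `j` coordinates. -/
def Differs (a : Fin w → Bool) (j : ℕ) (x : Fin w → Bool) : Prop :=
  ∃ i : Fin w, i.1 < j ∧ x i ≠ a i

/-- The points `a` and `x` differ in coordinate `j`. -/
def DiffersAt (a : Fin w → Bool) (j : ℕ) (x : Fin w → Bool) : Prop :=
  ∃ i : Fin w, i.1 = j ∧ x i ≠ a i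

theorem not_differs_zero (a x : Fin w → Bool) : ¬ Differs a 0 x := by
  simp [Differs]

theorem differs_succ_iff {a x : Fin w → Bool} {j : ℕ} :
    Differs a (j + 1) x ↔ Differs a j x ∨ DiffersAt a j x := by
  simp only [Differs, DiffersAt, ← exists_or, ← or_and_right, Nat.lt_succ_iff_lt_or_eq]

theorem eq_of_not_differs {a x : Fin w → Bool} (h : ¬ Differs a w x) : x = a := by
  funext i
  by_contra hi
  exact h ⟨i, i.2, hi⟩

open Classical in
/-- The colour of a node in the colouring that belongs to a point of the cube. -/
noncomputable def nodeColour : GadgetNode L w → (Fin w → Bool) → Fin 3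
  | .inl (_, .inl c), _ => c
  | .inl (_, .inr (j, b)), x => if x j = b then 1 else 0
  | .inr (_, a, j, k), x =>
    if Differs a j x then ![1, 0, 2] k else if DiffersAt a j x then ![0, 2, 0] k else ![0, 1, 2] k

open Classical in
theorem nodeColour_compare_zero (s : Bool) (a : Fin w → Bool) (j : Fin (w + 1))
    (x : Fin w → Bool) :
    nodeColour (L := L) (.inr (s, a, j, 0)) x = if Differs a j x then 1 else 0 := by
  simp [nodeColour]

/-- The layer of a node. -/
def layer : GadgetNode L w → ℕ
  | .inl (i, _) => i
  | .inr (false, _) => 0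
  | .inr (true, _) => L

theorem layer_le (v : GadgetNode L w) : layer v ≤ L := by
  rcases v with ⟨i, _⟩ | ⟨_ | _, _⟩ <;> simp [layer]
  omega

/-- The points of the cube that a node has to take into account. -/
def Relevant (S T : Set (Fin w → Bool)) (v : GadgetNode L w) (x : Fin w → Bool) : Prop :=
  (layer v = 0 → x ∈ S) ∧ (layer v = L → x ∈ T)

/-- The graph with `S` encoded at the first end and `T` at the second end. -/
def gadgetGraph (L w : ℕ) (S T : Set (Fin w → Bool)) : SimpleGraph (GadgetNode L w) where
  Adj u v := u ≠ v ∧ layer u ≤ layer v + 1 ∧ layer v ≤ layer u + 1 ∧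
    ∀ x, Relevant S T u x → Relevant S T v x → nodeColour u x ≠ nodeColour v x
  symm := ⟨fun _ _ h => ⟨h.1.symm, h.2.2.1, h.2.1, fun x hv hu => (h.2.2.2 x hu hv).symm⟩⟩
  loopless := ⟨fun _ h => h.1 rfl⟩

variable {S T S' T' : Set (Fin w → Bool)}

theorem gadgetGraph_adj_of_nodeColour {u v : GadgetNode L w} (h : layer u ≤ layer v + 1)
    (h' : layer v ≤ layer u + 1) (hc : ∀ x, nodeColour u x ≠ nodeColour v x) :
    (gadgetGraph L w S T).Adj u v :=
  ⟨fun huv => hc (fun _ => false) (by rw [huv]), h, h', fun x _ _ => hc x⟩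

theorem gadgetGraph_adj_congr_left {u v : GadgetNode L w} (hu : layer u < L) (hv : layer v < L) :
    (gadgetGraph L w S T).Adj u v ↔ (gadgetGraph L w S T').Adj u v := by
  simp [gadgetGraph, Relevant, hu.ne, hv.ne]

theorem gadgetGraph_adj_congr_right {u v : GadgetNode L w} (hu : 0 < layer u) (hv : 0 < layer v) :
    (gadgetGraph L w S T).Adj u v ↔ (gadgetGraph L w S' T).Adj u v := by
  simp [gadgetGraph, Relevant, hu.ne', hv.ne']

/-- Edges join only nodes whose colours differ at every relevant point, so evaluation at a point of
`S ∩ T` is proper by construction. -/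
theorem gadgetGraph_colorable {x : Fin w → Bool} (hS : x ∈ S) (hT : x ∈ T) :
    (gadgetGraph L w S T).Colorable 3 :=
  ⟨Coloring.mk (fun v => nodeColour v x) fun h =>
    h.2.2.2 x ⟨fun _ => hS, fun _ => hT⟩ ⟨fun _ => hS, fun _ => hT⟩⟩

/-- The node of colour `c` in layer `i`. -/
abbrev colourNode (i : Fin (L + 1)) (c : Fin 3) : GadgetNode L w := .inl (i, .inl c)

/-- The literal in layer `i` that says that coordinate `j` is `b`. -/
abbrev literalNode (i : Fin (L + 1)) (j : Fin w) (b : Bool) : GadgetNode L w := .inl (i, .inr (j, b))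

theorem nodeColour_literalNode_ne_two (i : Fin (L + 1)) (j : Fin w) (b : Bool) (x : Fin w → Bool) :
    nodeColour (literalNode i j b) x ≠ 2 := by
  simp only [nodeColour]
  split_ifs <;> decide

theorem nodeColour_compare_zero_ne_two (s : Bool) (a : Fin w → Bool) (j : Fin (w + 1))
    (x : Fin w → Bool) : nodeColour (L := L) (.inr (s, a, j, 0)) x ≠ 2 := by
  simp only [nodeColour]
  split_ifs <;> simp

theorem nodeColour_compare_two_ne_one (s : Bool) (a : Fin w → Bool) (j : Fin (w + 1))
    (x : Fin w → Bool) : nodeColour (L := L) (.inr (s, a, j, 2)) x ≠ 1 := by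
  simp only [nodeColour]
  split_ifs <;> simp

theorem nodeColour_compare_one_ne_compare_two (s : Bool) (a : Fin w → Bool) (j : Fin (w + 1))
    (x : Fin w → Bool) : nodeColour (L := L) (.inr (s, a, j, 1)) x ≠
      nodeColour (L := L) (.inr (s, a, j, 2)) x := by
  simp only [nodeColour]
  split_ifs <;> simp

theorem exists_layer_eq (v : GadgetNode L w) : ∃ i : Fin (L + 1), i.1 = layer v :=
  ⟨⟨layer v, Nat.lt_succ_of_le (layer_le v)⟩, rfl⟩

theorem gadgetGraph_adj_colourNode {v : GadgetNode L w} {i : Fin (L + 1)} (hi : i.1 = layer v)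
    {c : Fin 3} (hc : ∀ x, nodeColour v x ≠ c) : (gadgetGraph L w S T).Adj v (colourNode i c) :=
  gadgetGraph_adj_of_nodeColour (by simp [layer, hi]) (by simp [layer, hi]) hc

/-- A node that never takes colour `c` is adjacent to the node of colour `c` in its layer. Only the
compare nodes with index 1 may take all three colours; they are reached through their partners with
index 2. -/
theorem gadgetGraph_connected (S T : Set (Fin w → Bool)) : (gadgetGraph L w S T).Connected := by
  have hsucc : ∀ (i i' : Fin (L + 1)) (c c' : Fin 3), i'.1 ≤ i.1 + 1 → i.1 ≤ i'.1 + 1 → c ≠ c' →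
      (gadgetGraph L w S T).Adj (colourNode i c) (colourNode i' c') :=
    fun i i' c c' hi hi' hc => gadgetGraph_adj_of_nodeColour hi' hi fun _ => hc
  have hlayer : ∀ (i : Fin (L + 1)) (c c' : Fin 3),
      (gadgetGraph L w S T).Reachable (colourNode i c) (colourNode i c') := fun i c c' => by
    rcases eq_or_ne c c' with rfl | h
    · exact .rfl
    · exact (hsucc i i c c' (by omega) (by omega) h).reachable
  have hcolour : ∀ (i : ℕ) (hi : i < L + 1) (c : Fin 3),
      (gadgetGraph L w S T).Reachable (colourNode 0 0) (colourNode ⟨i, hi⟩ c) := by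
    intro i
    induction i with
    | zero => exact fun _ c => hlayer 0 0 c
    | succ i ih =>
      intro hi c
      exact (ih (by omega) 0).trans <|
        (hsucc _ _ 0 1 (by simp) (by simp; omega) (by decide)).reachable.trans (hlayer _ 1 c)
  have havoid : ∀ (v : GadgetNode L w) (c : Fin 3), (∀ x, nodeColour v x ≠ c) →
      (gadgetGraph L w S T).Reachable (colourNode 0 0) v := fun v c hv => by
    obtain ⟨i, hi⟩ := exists_layer_eq v
    exact (hcolour i i.2 c).trans (gadgetGraph_adj_colourNode hi hv).symm.reachable
  have hroot : ∀ v, (gadgetGraph L w S T).Reachable (colourNode 0 0) v := by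
    rintro (⟨i, c | ⟨j, b⟩⟩ | ⟨s, a, j, k⟩)
    · exact hcolour i i.2 c
    · exact havoid _ 2 (nodeColour_literalNode_ne_two i j b)
    · have h2 := havoid _ 1 (nodeColour_compare_two_ne_one (L := L) s a j)
      have h1 : (gadgetGraph L w S T).Adj (.inr (s, a, j, 1)) (.inr (s, a, j, 2)) := by
        refine gadgetGraph_adj_of_nodeColour ?_ ?_ (nodeColour_compare_one_ne_compare_two s a j) <;>
          cases s <;> simp [layer]
      fin_cases k
      · exact havoid _ 2 (nodeColour_compare_zero_ne_two s a j)
      · exact h2.trans h1.symm.reachable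
      · exact h2
  exact { preconnected := fun u v => (hroot u).symm.trans (hroot v), nonempty := ⟨colourNode 0 0⟩ }

/-- A proper 3-colouring gives the colour `c` to the node of colour `c` in every layer, after a
permutation of the colours. -/
theorem exists_normalized_coloring (h : (gadgetGraph L w S T).Colorable 3) :
    ∃ C : (gadgetGraph L w S T).Coloring (Fin 3), ∀ i c, C (colourNode i c) = c := by
  obtain ⟨C⟩ := h
  have hadj : ∀ (i i' : Fin (L + 1)) (c c' : Fin 3), i'.1 ≤ i.1 + 1 → i.1 ≤ i'.1 + 1 → c ≠ c' →
      C (colourNode i c) ≠ C (colourNode i' c') := fun i i' c c' hi hi' hc =>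
    C.valid (gadgetGraph_adj_of_nodeColour hi' hi fun _ => hc)
  have hinj : Function.Injective fun c => C (colourNode 0 c) := fun c c' hcc => by
    by_contra hne
    exact hadj 0 0 c c' (by omega) (by omega) hne hcc
  obtain ⟨σ, hσ⟩ : ∃ σ : Equiv.Perm (Fin 3), ∀ c, σ c = C (colourNode 0 c) :=
    ⟨Equiv.ofBijective _ (Finite.injective_iff_bijective.1 hinj), fun c => rfl⟩
  have hall : ∀ (i : ℕ) (hi : i < L + 1) (c : Fin 3), C (colourNode ⟨i, hi⟩ c) = σ c := by
    intro i
    induction i with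
    | zero => exact fun _ c => (hσ c).symm
    | succ i ih =>
      intro hi c
      -- The node of colour `c'` in layer `i` already has this colour, and it is adjacent to that of
      -- colour `c` in layer `i + 1` unless `c' = c`.
      obtain ⟨c', hc'⟩ := σ.surjective (C (colourNode ⟨i + 1, hi⟩ c))
      by_contra hne
      have hcc : c' ≠ c := fun h => hne (by rw [← hc', h])
      refine hadj ⟨i, by omega⟩ ⟨i + 1, hi⟩ c' c (by simp) (by simp; omega) hcc ?_
      rw [ih, hc']
  refine ⟨Coloring.mk (fun v => σ.symm (C v)) fun hv heq =>
    C.valid hv (σ.symm.injective heq), fun i c => ?_⟩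
  change σ.symm (C (colourNode i c)) = c
  rw [Equiv.symm_apply_eq]
  exact hall i i.2 c

theorem coloring_literalNode_ne (C : (gadgetGraph L w S T).Coloring (Fin 3)) (i i' : Fin (L + 1))
    (hi : i'.1 ≤ i.1 + 1) (hi' : i.1 ≤ i'.1 + 1)
    (j : Fin w) (b : Bool) : C (literalNode i j b) ≠ C (literalNode i' j !b) := by
  refine C.valid (gadgetGraph_adj_of_nodeColour hi' hi fun x => ?_)
  simp only [nodeColour]
  cases x j <;> cases b <;> simp

section Normalized

variable {C : (gadgetGraph L w S T).Coloring (Fin 3)} (hC : ∀ i c, C (colourNode i c) = c)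
include hC

theorem coloring_ne_of_nodeColour_ne {v : GadgetNode L w} {c : Fin 3}
    (h : ∀ x, nodeColour v x ≠ c) : C v ≠ c := by
  obtain ⟨i, hi⟩ := exists_layer_eq v
  have := C.valid (gadgetGraph_adj_colourNode (S := S) (T := T) hi h)
  rwa [hC] at this

/-- Literals avoid colour 2, and each differs from the opposite literal in its own and in the
adjacent layers; so truth values travel unchanged along the wire. -/
theorem coloring_literalNode_eq (i : ℕ) (hi : i < L + 1) (j : Fin w) (b : Bool) :
    C (literalNode ⟨i, hi⟩ j b) = C (literalNode 0 j b) := by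
  induction i with
  | zero => rfl
  | succ i ih =>
    rw [← ih (by omega)]
    have h1 := coloring_literalNode_ne C ⟨i, by omega⟩ ⟨i, by omega⟩ (by simp) (by simp) j b
    have h2 := coloring_literalNode_ne C ⟨i + 1, hi⟩ ⟨i, by omega⟩ (by simp; omega) (by simp) j b
    have h3 := coloring_ne_of_nodeColour_ne hC (nodeColour_literalNode_ne_two ⟨i, by omega⟩ j b)
    have h4 := coloring_ne_of_nodeColour_ne hC (nodeColour_literalNode_ne_two ⟨i, by omega⟩ j !b)
    have h5 := coloring_ne_of_nodeColour_ne hC (nodeColour_literalNode_ne_two ⟨i + 1, hi⟩ j b)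
    omega

theorem exists_coloring_literalNode_eq_zero :
    ∃ a : Fin w → Bool, ∀ i j, C (literalNode i j !(a j)) = 0 := by
  refine ⟨fun j => decide (C (literalNode 0 j true) = 1), fun i j => ?_⟩
  rw [coloring_literalNode_eq hC i i.2]
  have h1 := coloring_literalNode_ne C 0 0 (by omega) (by omega) j true
  have h2 := coloring_ne_of_nodeColour_ne hC (nodeColour_literalNode_ne_two 0 j true)
  have h3 := coloring_ne_of_nodeColour_ne hC (nodeColour_literalNode_ne_two 0 j false)
  rw [Bool.not_true] at h1
  by_cases h : C (literalNode 0 j true) = 1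
  · simp only [h, decide_true, Bool.not_true]
    omega
  · simp only [h, decide_false, Bool.not_false]
    omega

/-- The compare nodes form a chain of OR gadgets. Node `(j + 1, 0)` is in a triangle with `(j, 1)`
and `(j, 2)`, which are joined to the inputs `(j, 0)` and the literal "coordinate `j` differs from
`a j`". If both inputs have colour 0, the two nodes use up colours 1 and 2, and the output is 0. -/
theorem coloring_compare_eq_zero {a : Fin w → Bool} (ha : ∀ i j, C (literalNode i j !(a j)) = 0)
    (s : Bool) (j : ℕ) (hj : j < w + 1) : C (.inr (s, a, ⟨j, hj⟩, 0)) = 0 := by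
  have hadj : ∀ {j j' : Fin (w + 1)} {k k' : Fin 3},
      (∀ x, nodeColour (L := L) (.inr (s, a, j, k)) x ≠ nodeColour (L := L) (.inr (s, a, j', k')) x) →
      C (.inr (s, a, j, k)) ≠ C (.inr (s, a, j', k')) := fun h => by
    refine C.valid (gadgetGraph_adj_of_nodeColour ?_ ?_ h) <;> cases s <;> simp [layer]
  induction j with
  | zero =>
    have h2 := coloring_ne_of_nodeColour_ne hC (nodeColour_compare_zero_ne_two s a ⟨0, hj⟩)
    have h1 : C (.inr (s, a, ⟨0, hj⟩, 0)) ≠ 1 := coloring_ne_of_nodeColour_ne hC fun x => by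
      simp only [nodeColour, not_differs_zero, if_false]
      split_ifs <;> simp
    omega
  | succ j ih =>
    have h0 := ih (by omega)
    have hl : C (.inr (s, a, ⟨j, by omega⟩, 2)) ≠ 0 := by
      obtain ⟨i, hi⟩ := exists_layer_eq (L := L) (.inr (s, a, ⟨j, by omega⟩, 2))
      rw [← ha i ⟨j, by omega⟩]
      refine C.valid (gadgetGraph_adj_of_nodeColour (by simp [layer, hi]) (by simp [layer, hi])
        fun x => ?_)
      have hx : DiffersAt a j x ↔ x ⟨j, by omega⟩ = !(a ⟨j, by omega⟩) := by
        rw [Bool.eq_not]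
        exact ⟨fun ⟨i, hi, h⟩ => by subst hi; exact h, fun h => ⟨_, rfl, h⟩⟩
      simp only [nodeColour]
      split_ifs <;> simp_all
    have hp : C (.inr (s, a, ⟨j, by omega⟩, 1)) ≠ C (.inr (s, a, ⟨j, by omega⟩, 0)) :=
      hadj fun x => by
        simp only [nodeColour]
        split_ifs <;> simp
    have hpq := hadj (nodeColour_compare_one_ne_compare_two s a ⟨j, by omega⟩)
    have hop : C (.inr (s, a, ⟨j + 1, hj⟩, 0)) ≠ C (.inr (s, a, ⟨j, by omega⟩, 1)) :=
      hadj fun x => by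
        rw [nodeColour_compare_zero, differs_succ_iff]
        by_cases h1 : Differs a j x <;> by_cases h2 : DiffersAt a j x <;> simp [nodeColour, h1, h2]
    have hoq : C (.inr (s, a, ⟨j + 1, hj⟩, 0)) ≠ C (.inr (s, a, ⟨j, by omega⟩, 2)) :=
      hadj fun x => by
        rw [nodeColour_compare_zero, differs_succ_iff]
        by_cases h1 : Differs a j x <;> by_cases h2 : DiffersAt a j x <;> simp [nodeColour, h1, h2]
    omega

/-- If `a` were not allowed at this end, the final output for `a` would be 1 at all relevant points,
hence adjacent to the node of colour 0; but its colour is 0. -/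
theorem exists_relevant {a : Fin w → Bool} (ha : ∀ i j, C (literalNode i j !(a j)) = 0)
    (s : Bool) : Relevant (L := L) S T (.inr (s, a, ⟨w, by omega⟩, 0)) a := by
  by_contra hrel
  obtain ⟨i, hi⟩ := exists_layer_eq (L := L) (.inr (s, a, ⟨w, by omega⟩, 0))
  have hadj : (gadgetGraph L w S T).Adj (.inr (s, a, ⟨w, by omega⟩, 0)) (colourNode i 0) := by
    refine ⟨by simp, by simp [layer, hi], by simp [layer, hi], fun x hx _ => ?_⟩
    have hd : Differs a w x := by
      by_contra h
      exact hrel (eq_of_not_differs h ▸ hx)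
    simp [nodeColour, hd]
  exact C.valid hadj (by rw [hC, coloring_compare_eq_zero hC ha])

end Normalized

theorem gadgetGraph_colorable_iff :
    (gadgetGraph L w S T).Colorable 3 ↔ (S ∩ T).Nonempty := by
  refine ⟨fun h => ?_, fun ⟨_, hS, hT⟩ => gadgetGraph_colorable hS hT⟩
  obtain ⟨C, hC⟩ := exists_normalized_coloring h
  obtain ⟨a, ha⟩ := exists_coloring_literalNode_eq_zero hC
  exact ⟨a, (exists_relevant hC ha false).1 rfl, (exists_relevant hC ha true).2 rfl⟩

/-! ### Transport to `Fin n` -/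

/-- The numbering of the nodes. -/
noncomputable abbrev nodeEquiv (L w : ℕ) :
    Fin (Fintype.card (GadgetNode L w)) ≃ GadgetNode L w :=
  (Fintype.equivFin _).symm

/-- The instance of a gadget graph, all of whose inputs are `0`. -/
noncomputable def gadgetConfig (M : ℕ → ℕ) (L w : ℕ) (S T : Set (Fin w → Bool)) : Config M where
  n := Fintype.card (GadgetNode L w)
  graph := (gadgetGraph L w S T).comap (nodeEquiv L w)
  connected := (Iso.comap (nodeEquiv L w) _).connected_iff.2 (gadgetGraph_connected S T)
  input := fun _ => 0
  input_le := fun _ => Nat.zero_le _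

theorem gadgetConfig_mem {M : ℕ → ℕ} :
    gadgetConfig M L w S T ∈ nonThreeColourability M ↔ ¬ (S ∩ T).Nonempty := by
  rw [← gadgetGraph_colorable_iff (L := L)]
  refine not_congr ⟨fun h => ?_, fun h => ?_⟩
  · exact h.of_hom (Iso.comap (nodeEquiv L w) (gadgetGraph L w S T)).symm.toHom
  · exact h.of_hom (Iso.comap (nodeEquiv L w) (gadgetGraph L w S T)).toHom

theorem gadgetConfig_adj_layer {M : ℕ → ℕ} (u v : Fin (Fintype.card (GadgetNode L w)))
    (h : (gadgetConfig M L w S T).graph.Adj u v) :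
    layer (nodeEquiv L w u) ≤ layer (nodeEquiv L w v) + 1 ∧
      layer (nodeEquiv L w v) ≤ layer (nodeEquiv L w u) + 1 :=
  ⟨h.2.1, h.2.2.1⟩

/-- Acceptance is preserved when one half of a labelled gadget graph is replaced, provided that the
labels of the wires agree. -/
theorem accepts_hybrid {M : ℕ → ℕ} {A : LocalAlgorithm} (hL : L = 2 * A.radius + 1)
    {ident : Fin (Fintype.card (GadgetNode L w)) → ℕ}
    {l l' : Labelling (Fintype.card (GadgetNode L w))}
    (hl : A.Accepts (gadgetConfig M L w S T).graph (gadgetConfig M L w S T).input ident [l])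
    (hl' : A.Accepts (gadgetConfig M L w S' T').graph (gadgetConfig M L w S' T').input ident [l'])
    (heq : ∀ y, l ((nodeEquiv L w).symm (.inl y)) = l' ((nodeEquiv L w).symm (.inl y))) :
    A.Accepts (gadgetConfig M L w S T').graph (gadgetConfig M L w S T').input ident
      [fun v => if layer (nodeEquiv L w v) < L then l v else l' v] := by
  intro v
  by_cases hv : layer (nodeEquiv L w v) ≤ A.radius
  · rw [← hl v]
    congr 1
    refine view_congr_of_agree (pos := fun v => layer (nodeEquiv L w v)) (L := L)
      (gadgetConfig M L w S T').connected (gadgetConfig M L w S T).connected _ _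
      (fun u v h => (gadgetConfig_adj_layer u v h).2) (fun u v h => (gadgetConfig_adj_layer u v h).2)
      (fun u v hu hv => gadgetGraph_adj_congr_left hu hv) (fun v hv => if_pos hv) (by omega)
  · rw [← hl' v]
    congr 1
    -- Measured from the far end: the node has layer at least `t + 1`, so it sees only positive
    -- layers, where `S` plays no role.
    refine view_congr_of_agree (pos := fun v => L - layer (nodeEquiv L w v)) (L := L)
      (gadgetConfig M L w S T').connected (gadgetConfig M L w S' T').connected _ _
      (fun u v h => ?_) (fun u v h => ?_)
      (fun u v hu hv => gadgetGraph_adj_congr_right (by omega) (by omega)) (fun v hv => ?_) ?_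
    · have := gadgetConfig_adj_layer u v h
      omega
    · have := gadgetConfig_adj_layer u v h
      omega
    -- Strictly between the ends there are only wire nodes, on which `l` and `l'` agree.
    · split_ifs with h
      · obtain ⟨y, rfl⟩ := (nodeEquiv L w).symm.surjective v
        rw [Equiv.apply_symm_apply] at h hv
        rcases y with y | ⟨_ | _, y⟩
        · exact heq y
        · simp [layer] at hv
        · simp [layer] at h
      · rfl
    · have := layer_le (nodeEquiv L w v)
      omega

/-! ### Counting -/

theorem card_gadgetNode_le (L w : ℕ) :
    Fintype.card (GadgetNode L w) ≤ 2 ^ (3 * L + 9 + 2 * w) := by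
  have hw : w + 1 ≤ 2 ^ w := Nat.lt_two_pow_self
  have hD : 3 * L + 9 ≤ 2 ^ (3 * L + 9) := Nat.lt_two_pow_self.le
  have hone : 1 ≤ 2 ^ w := Nat.one_le_two_pow
  simp only [Fintype.card_sum, Fintype.card_prod, Fintype.card_fin, Fintype.card_bool,
    Fintype.card_fun]
  have h1 : 3 + w * 2 ≤ 3 * (2 ^ w * 2 ^ w) := by nlinarith
  have h2 : 2 * (2 ^ w * ((w + 1) * 3)) ≤ 6 * (2 ^ w * 2 ^ w) := by nlinarith
  calc (L + 1) * (3 + w * 2) + 2 * (2 ^ w * ((w + 1) * 3))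
      ≤ (L + 1) * (3 * (2 ^ w * 2 ^ w)) + 6 * (2 ^ w * 2 ^ w) := by gcongr
    _ = (3 * L + 9) * (2 ^ w * 2 ^ w) := by ring
    _ ≤ 2 ^ (3 * L + 9) * (2 ^ w * 2 ^ w) := by gcongr
    _ = 2 ^ (3 * L + 9 + 2 * w) := by ring

theorem exists_mul_sq_lt_two_pow (C : ℕ) : ∃ w, C * (w + 1) ^ 2 < 2 ^ w := by
  have h := tendsto_pow_const_div_const_pow_of_one_lt 2 (one_lt_two (α := ℝ))
  -- The factor 2 pays for the shift from `2 ^ (w + 1)` to `2 ^ w`.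
  have hpos : (0 : ℝ) < 1 / (2 * C + 1) := by positivity
  obtain ⟨w, hw, hw1⟩ := ((h.eventually (gt_mem_nhds hpos)).and
    (Filter.eventually_ge_atTop 1)).exists
  obtain ⟨w, rfl⟩ := Nat.exists_eq_add_of_le' hw1
  refine ⟨w, ?_⟩
  rw [div_lt_div_iff₀ (by positivity) (by positivity)] at hw
  have hw' : (w + 1) ^ 2 * (2 * C + 1) < 1 * 2 ^ (w + 1) := by exact_mod_cast hw
  rw [pow_succ 2 w] at hw'
  nlinarith [sq_nonneg (w + 1)]

theorem exists_counting_bound (c D L : ℕ) :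
    ∃ w, 2 * (c * (D + 2 * w) * ((L + 1) * (3 + w * 2))) < 2 ^ w := by
  obtain ⟨w, hw⟩ := exists_mul_sq_lt_two_pow (2 * (c * (D + 2) * ((L + 1) * 3)))
  refine ⟨w, lt_of_le_of_lt ?_ hw⟩
  have h1 : D + 2 * w ≤ (D + 2) * (w + 1) := by nlinarith
  have h2 : 3 + w * 2 ≤ 3 * (w + 1) := by omega
  calc 2 * (c * (D + 2 * w) * ((L + 1) * (3 + w * 2)))
      ≤ 2 * (c * ((D + 2) * (w + 1)) * ((L + 1) * (3 * (w + 1)))) := by gcongr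
    _ = _ := by ring

theorem length_le_of_sizeLE {n c b : ℕ} (hn : n ≤ 2 ^ b) {l : Labelling n}
    (h : Labelling.SizeLE c l) (v : Fin n) : (l v).length ≤ c * b := by
  have hpos : (0 : ℝ) < n := by exact_mod_cast v.pos
  have hlog : Real.logb 2 n ≤ b := by
    rw [Real.logb_le_iff_le_rpow one_lt_two hpos, Real.rpow_natCast]
    exact_mod_cast hn
  have := (h v).trans (mul_le_mul_of_nonneg_left hlog (Nat.cast_nonneg c))
  exact_mod_cast this

theorem eq_of_getElem?_eq {K : ℕ} {l l' : List Bool} (h : l.length ≤ K) (h' : l'.length ≤ K)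
    (heq : (fun i : Fin K => l[i.1]?) = fun i : Fin K => l'[i.1]?) : l = l' := by
  refine List.ext_getElem? fun i => ?_
  by_cases hi : i < K
  · exact congrFun heq ⟨i, hi⟩
  · rw [List.getElem?_eq_none (by omega), List.getElem?_eq_none (by omega)]

/-! ### The lower bound -/

theorem nonThreeColourability_notMem_SigmaClass_one {N : ℕ → ℕ} (M : ℕ → ℕ)
    (hN : ∀ n, n ≤ N n) : nonThreeColourability M ∉ SigmaClass N M 1 := by
  rw [mem_SigmaClass_one]
  rintro ⟨c, A, hA⟩
  obtain ⟨L, hL⟩ : ∃ L, L = 2 * A.radius + 1 := ⟨_, rfl⟩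
  obtain ⟨w, hw⟩ := exists_counting_bound c (3 * L + 9) L
  -- The node set does not depend on `S` and `T`, so one identity assignment serves all gadgets.
  have hid : IsIdAssignment N fun v : Fin (Fintype.card (GadgetNode L w)) => v.1 + 1 :=
    ⟨fun u v h => Fin.ext (Nat.succ_injective h),
      fun v => ⟨Nat.le_add_left _ _, le_trans v.2 (hN _)⟩⟩
  have hiff := fun S T => (gadgetConfig_mem.symm.trans (hA (gadgetConfig M L w S T) _ hid))
  have hcert : ∀ S : Set (Fin w → Bool), ∃ l : Labelling (Fintype.card (GadgetNode L w)),
      Labelling.SizeLE c l ∧ A.Accepts (gadgetConfig M L w S Sᶜ).graph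
        (gadgetConfig M L w S Sᶜ).input (fun v => v.1 + 1) [l] := fun S =>
    (hiff S Sᶜ).1 (by simp)
  choose l hsize hacc using hcert
  have hsub : ∀ S T : Set (Fin w → Bool),
      (∀ y, l S ((nodeEquiv L w).symm (.inl y)) = l T ((nodeEquiv L w).symm (.inl y))) →
      S ⊆ T := by
    intro S T heq
    have := (hiff S Tᶜ).2 ⟨_, fun v => ?_, accepts_hybrid hL (hacc S) (hacc T) heq⟩
    · rwa [Set.not_nonempty_iff_eq_empty, ← Set.sdiff_eq, Set.sdiff_eq_empty] at this
    · split_ifs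
      exacts [hsize S v, hsize T v]
  obtain ⟨K, hK⟩ : ∃ K, K = c * (3 * L + 9 + 2 * w) := ⟨_, rfl⟩
  -- A label of at most `K` bits is coded by its `K` optional entries, giving at most `3 ^ K` codes
  -- per wire node.
  have hinj : Function.Injective fun (S : Set (Fin w → Bool)) (y : Fin (L + 1) × WireNode w)
      (i : Fin K) => (l S ((nodeEquiv L w).symm (.inl y)))[i.1]? := by
    intro S T hST
    have heq : ∀ y, l S ((nodeEquiv L w).symm (.inl y)) = l T ((nodeEquiv L w).symm (.inl y)) :=
      fun y => eq_of_getElem?_eq (hK ▸ length_le_of_sizeLE (card_gadgetNode_le L w) (hsize S) _)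
        (hK ▸ length_le_of_sizeLE (card_gadgetNode_le L w) (hsize T) _) (congrFun hST y)
    exact (hsub S T heq).antisymm (hsub T S fun y => (heq y).symm)
  have hcard := Fintype.card_le_of_injective _ hinj
  simp only [Fintype.card_set, Fintype.card_fun, Fintype.card_option, Fintype.card_bool,
    Fintype.card_fin, Fintype.card_prod, Fintype.card_sum] at hcard
  have : 2 ^ 2 ^ w ≤ 2 ^ (2 * (K * ((L + 1) * (3 + w * 2)))) := calc
    2 ^ 2 ^ w ≤ ((2 + 1) ^ K) ^ ((L + 1) * (3 + w * 2)) := hcard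
    _ ≤ ((2 ^ 2) ^ K) ^ ((L + 1) * (3 + w * 2)) := by gcongr; norm_num
    _ = 2 ^ (2 * (K * ((L + 1) * (3 + w * 2)))) := by rw [← pow_mul, ← pow_mul]
  rw [Nat.pow_le_pow_iff_right one_lt_two] at this
  rw [hK] at this
  omega

/-! ### The classes of the first two levels -/

theorem Lam_one (N M : ℕ → ℕ) : Lam N M 1 = SigmaClass N M 1 := if_pos odd_one

theorem Lam_two (N M : ℕ → ℕ) : Lam N M 2 = PiClass N M 2 := if_neg (by decide)

theorem Lam_one_subset_Lam_two (N M : ℕ → ℕ) : Lam N M 1 ⊆ Lam N M 2 := by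
  rw [Lam_one, Lam_two]
  exact SigmaClass_one_subset_PiClass_two N M

theorem mem_coLam_iff {N M : ℕ → ℕ} {k : ℕ} {L : DistLanguage M} :
    L ∈ coLam N M k ↔ Lᶜ ∈ Lam N M k := Iff.rfl

theorem Lam_one_subset_coLam_two (N M : ℕ → ℕ) : Lam N M 1 ⊆ coLam N M 2 := by
  intro L hL
  rw [Lam_one] at hL
  rw [mem_coLam_iff, Lam_two]
  exact compl_mem_PiClass_two hL

theorem coLam_one_subset_Lam_two (N M : ℕ → ℕ) : coLam N M 1 ⊆ Lam N M 2 := by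
  intro L hL
  have := Lam_one_subset_coLam_two N M (mem_coLam_iff.1 hL)
  rwa [mem_coLam_iff, compl_compl] at this

theorem coLam_one_subset_coLam_two (N M : ℕ → ℕ) : coLam N M 1 ⊆ coLam N M 2 :=
  fun _ hL => Lam_one_subset_Lam_two N M hL

theorem compl_threeColourability (M : ℕ → ℕ) :
    (threeColourability M)ᶜ = nonThreeColourability M := rfl

theorem compl_nonThreeColourability (M : ℕ → ℕ) :
    (nonThreeColourability M)ᶜ = threeColourability M := by
  rw [← compl_threeColourability, compl_compl]

end LocalHierarchy

theorem mainTheorem7 (N M : ℕ → ℕ)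
    (hN : LocalHierarchy.PolyBounded N) (hNle : ∀ n, n ≤ N n)
    (hM : LocalHierarchy.PolyBounded M) :
    -- all inclusions between the first and second levels hold and are strict
    LocalHierarchy.Lam N M 1 ⊂ LocalHierarchy.Lam N M 2 ∧
    LocalHierarchy.Lam N M 1 ⊂ LocalHierarchy.coLam N M 2 ∧
    LocalHierarchy.coLam N M 1 ⊂ LocalHierarchy.Lam N M 2 ∧
    LocalHierarchy.coLam N M 1 ⊂ LocalHierarchy.coLam N M 2 ∧
    -- the hierarchy does not collapse to its first level
    LocalHierarchy.LH N M ≠ LocalHierarchy.Lam N M 1 ∧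
    -- the languages that separate the levels
    LocalHierarchy.nonThreeColourability M ∈
      (LocalHierarchy.Lam N M 2 ∩ LocalHierarchy.coLam N M 2) \ LocalHierarchy.Lam N M 1 ∧
    LocalHierarchy.threeColourability M ∈
      (LocalHierarchy.Lam N M 2 ∩ LocalHierarchy.coLam N M 2) \ LocalHierarchy.coLam N M 1 := by
  open LocalHierarchy in
  have h3 : threeColourability M ∈ Lam N M 1 := by
    rw [Lam_one]
    exact threeColourability_mem_SigmaClass_one N M
  have hnon : nonThreeColourability M ∈ coLam N M 1 := by
    rwa [mem_coLam_iff, compl_nonThreeColourability]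
  have hnon' : nonThreeColourability M ∉ Lam N M 1 := by
    rw [Lam_one]
    exact nonThreeColourability_notMem_SigmaClass_one M hNle
  have h3' : threeColourability M ∉ coLam N M 1 := by
    rwa [mem_coLam_iff, compl_threeColourability]
  have hnonΛ := coLam_one_subset_Lam_two N M hnon
  have hnonco := coLam_one_subset_coLam_two N M hnon
  have h3Λ := Lam_one_subset_Lam_two N M h3
  have h3co := Lam_one_subset_coLam_two N M h3
  exact ⟨⟨Lam_one_subset_Lam_two N M, fun h => hnon' (h hnonΛ)⟩,
    ⟨Lam_one_subset_coLam_two N M, fun h => hnon' (h hnonco)⟩,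
    ⟨coLam_one_subset_Lam_two N M, fun h => h3' (h h3Λ)⟩,
    ⟨coLam_one_subset_coLam_two N M, fun h => h3' (h h3co)⟩,
    fun h => hnon' (h ▸ Set.mem_iUnion.2 ⟨2, hnonΛ⟩),
    ⟨⟨hnonΛ, hnonco⟩, hnon'⟩, ⟨⟨h3Λ, h3co⟩, h3'⟩⟩
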